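/- Let $R$ be a commutative von Neumann regular ring, i.e. an associative commutative ring with $1$ such that for every $a\in R$ there is $x\in R$ with $a=axa$. Call an $R$-module $M$ *Mittag-Leffler* if for every family $(Q_i)_{i\in I}$ of $R$-modules the canonical map $M\otimes_R\prod_{i\in I}Q_i\to\prod_{i\in I}(M\otimes_R Q_i)$ is injective, and *strict Mittag-Leffler* if for every homomorphism $u\colon F\to M$ with $F$ finitely presented there are a finitely presented module $S$ and a homomorphism $v\colon F\to S$ such that $u=v'v$ for some $v'\colon S\to M$, and such that for every module $B$ and every homomorphism $f\colon S\to B$ there is $g\colon M\to B$ with $gu=fv$. Then the following statements are equivalent: (i) $R$ is $\pi$-coherent, i.e. for every set $I$, every finitely generated submodule of $R^I$ is finitely presented; (ii) the class $\mathcal D$ of all flat Mittag-Leffler $R$-modules is closed under arbitrary direct products; (iii) $R$ is self-injective, i.e. $R$ is injective as an $R$-module; (iv) $R$ is strongly coherent, i.e. the class of all flat strict Mittag-Leffler $R$-modules is closed under arbitrary direct products. -/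

import Mathlib

universe u

/-- A ring is von Neumann regular if every element `a` has a quasi-inverse `x`: `a = a * x * a`. -/
def IsVonNeumannRegular (R : Type u) [Ring R] : Prop :=
  ∀ a : R, ∃ x : R, a = a * x * a

/-- `R` is π-coherent: for any set `I`, every finitely generated submodule of `R ^ I` is finitely
presented. (Over a commutative ring there is no distinction of sides.) -/
def IsPiCoherent (R : Type u) [CommRing R] : Prop :=
  ∀ (I : Type u) (N : Submodule R (I → R)), N.FG → Module.FinitePresentation R N

/-- `M` is Mittag-Leffler: for every family `(Q i)` of modules, the canonical map
`M ⊗ (∏ i, Q i) → ∏ i, (M ⊗ Q i)` is injective. -/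
def IsMittagLefflerModule (R : Type u) [CommRing R]
    (M : Type u) [AddCommGroup M] [Module R M] : Prop :=
  ∀ (I : Type u) (Q : I → Type u) [∀ i, AddCommGroup (Q i)] [∀ i, Module R (Q i)],
    Function.Injective (TensorProduct.piRightHom R R M Q)

/-- `M` is strict Mittag-Leffler: every homomorphism `a : F → M` from a finitely presented module
factors as `a = b ∘ v` through some `v : F → S` with `S` finitely presented, such that for every
`f : S → B` there is `g : M → B` with `g ∘ a = f ∘ v`. -/
def IsStrictMittagLefflerModule (R : Type u) [CommRing R]
    (M : Type u) [AddCommGroup M] [Module R M] : Prop :=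
  ∀ (F : Type u) [AddCommGroup F] [Module R F], Module.FinitePresentation R F →
    ∀ a : F →ₗ[R] M,
      ∃ (S : Type u) (_ : AddCommGroup S) (_ : Module R S) (v : F →ₗ[R] S),
        Module.FinitePresentation R S ∧
        (∃ b : S →ₗ[R] M, a = b ∘ₗ v) ∧
        ∀ (B : Type u) [AddCommGroup B] [Module R B] (f : S →ₗ[R] B),
          ∃ g : M →ₗ[R] B, g ∘ₗ a = f ∘ₗ v

/-- Membership in the class `𝒟` of flat Mittag-Leffler modules. -/
def IsFlatMittagLeffler (R : Type u) [CommRing R]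
    (M : Type u) [AddCommGroup M] [Module R M] : Prop :=
  Module.Flat R M ∧ IsMittagLefflerModule R M

/-- Membership in the class `𝒮𝒟` of flat strict Mittag-Leffler modules. -/
def IsFlatStrictMittagLeffler (R : Type u) [CommRing R]
    (M : Type u) [AddCommGroup M] [Module R M] : Prop :=
  Module.Flat R M ∧ IsStrictMittagLefflerModule R M

/-- A class `C` of `R`-modules is closed under (arbitrary direct) products. -/
def IsClosedUnderProducts (R : Type u) [CommRing R]
    (C : ∀ (M : Type u) [AddCommGroup M] [Module R M], Prop) : Prop :=
  ∀ (I : Type u) (M : I → Type u) [∀ i, AddCommGroup (M i)] [∀ i, Module R (M i)],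
    (∀ i, C (M i)) → C (∀ i, M i)

/-- `R` is strongly coherent: the class of flat strict Mittag-Leffler modules is closed under
products. -/
def IsStronglyCoherent (R : Type u) [CommRing R] : Prop :=
  IsClosedUnderProducts R (fun M _ _ => IsFlatStrictMittagLeffler R M)

/-! Every module over `R` is flat, so only the Mittag-Leffler conditions matter, and these are
compared with Zelmanowitz regularity. A regular module has dual bases for its finitely generated
submodules (`IsRegularModule.exists_dualBasis_of_fg`), hence is both Mittag-Leffler and strict
Mittag-Leffler. Over `R` strict Mittag-Leffler modules are regular, whereas Mittag-Leffler ones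
visibly have only support elements. Self-injectivity removes this gap and carries support elements
through products, so (iii) gives (ii) and (iv). Either closure property, applied to powers of `R`,
gives (i), and (i) gives Baer's criterion (`IsPiCoherent.injective_self`). -/

theorem IsVonNeumannRegular.exists_eq_span_of_fg {R : Type u} [CommRing R]
    (hR : IsVonNeumannRegular R) (I : Ideal R) (hI : I.FG) :
    ∃ e : R, IsIdempotentElem e ∧ I = Ideal.span {e} := by
  refine (Ideal.isIdempotentElem_iff_of_fg I hI).mp (le_antisymm Ideal.mul_le_right fun a ha => ?_)
  obtain ⟨x, hx⟩ := hR a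
  rw [hx]
  exact Ideal.mul_mem_mul (I.mul_mem_right x ha) ha

theorem IsVonNeumannRegular.flat {R : Type u} [CommRing R] (hR : IsVonNeumannRegular R)
    (M : Type u) [AddCommGroup M] [Module R M] : Module.Flat R M := by
  refine Module.Flat.iff_rTensor_injective.mpr fun I hI => ?_
  obtain ⟨e, he, rfl⟩ := hR.exists_eq_span_of_fg I hI
  let r : R →ₗ[R] Ideal.span {e} :=
    (LinearMap.lsmul R R e).codRestrict _ fun x =>
      Ideal.mul_mem_right x _ (Ideal.mem_span_singleton_self e)
  have hr : r ∘ₗ Submodule.subtype (Ideal.span {e}) = LinearMap.id := by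
    ext ⟨x, hx⟩
    obtain ⟨y, rfl⟩ := Ideal.mem_span_singleton'.mp hx
    change e * (y * e) = y * e
    rw [mul_left_comm, he.eq]
  refine Function.LeftInverse.injective (g := r.rTensor M) fun z => ?_
  rw [← LinearMap.comp_apply, ← LinearMap.rTensor_comp, hr, LinearMap.rTensor_id,
    LinearMap.id_apply]

/-! ### Regular modules and dual bases -/

/-- `M` is a regular module in the sense of Zelmanowitz: every `x : M` satisfies `h x • x = x` for
some linear form `h`. -/
def IsRegularModule (R : Type u) [CommRing R] (M : Type u) [AddCommGroup M] [Module R M] : Prop :=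
  ∀ x : M, ∃ h : M →ₗ[R] R, h x • x = x

/-- Every `x : M` has the same annihilator as some `e : R` which fixes `x`. -/
def HasSupportElements (R : Type u) [CommRing R] (M : Type u) [AddCommGroup M] [Module R M] :
    Prop :=
  ∀ x : M, ∃ e : R, e • x = x ∧ ∀ r : R, r • x = 0 → r * e = 0

section Regular

variable {R : Type u} [CommRing R] {M : Type u} [AddCommGroup M] [Module R M]

theorem IsRegularModule.hasSupportElements (hM : IsRegularModule R M) :
    HasSupportElements R M := fun x => by
  obtain ⟨h, hx⟩ := hM x
  refine ⟨h x, hx, fun r hr => ?_⟩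
  rw [← smul_eq_mul, ← map_smul, hr, map_zero]

theorem IsRegularModule.of_injective {N : Type u} [AddCommGroup N] [Module R N]
    (hN : IsRegularModule R N) (i : M →ₗ[R] N) (hi : Function.Injective i) :
    IsRegularModule R M := fun x => by
  obtain ⟨h, hx⟩ := hN (i x)
  exact ⟨h ∘ₗ i, hi (by rw [map_smul, LinearMap.comp_apply, hx])⟩

/-- Finitely generated submodules of a regular module have a finite dual basis which is defined on
the whole module. -/
theorem IsRegularModule.exists_dualBasis_of_fg (hM : IsRegularModule R M) (N : Submodule R M)
    (hN : N.FG) :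
    ∃ (n : ℕ) (h : Fin n → M →ₗ[R] R) (x : Fin n → N), ∀ y ∈ N, ∑ k, h k y • (x k : M) = y := by
  classical
  obtain ⟨s, rfl⟩ := hN
  induction s using Finset.induction_on with
  | empty => exact ⟨0, Fin.elim0, Fin.elim0, fun y hy => by simpa [eq_comm] using hy⟩
  | insert a s _ ih =>
    obtain ⟨n, h, x, hx⟩ := ih
    have hle : Submodule.span R (s : Set M) ≤ Submodule.span R ((insert a s : Finset M) : Set M) :=
      Submodule.span_mono (by simp)
    have ha : a ∈ Submodule.span R ((insert a s : Finset M) : Set M) :=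
      Submodule.subset_span (by simp)
    let p : M →ₗ[R] M := ∑ k, (h k).smulRight (x k : M)
    have hp (y : M) : p y = ∑ k, h k y • (x k : M) := by simp [p]
    have hpmem (y : M) : p y ∈ Submodule.span R (s : Set M) := by
      rw [hp]
      exact Submodule.sum_mem _ fun k _ => Submodule.smul_mem _ _ (x k).2
    -- Since `p` fixes the old span, only the residue `a - p a` needs a new form.
    obtain ⟨g, hg⟩ := hM (a - p a)
    refine ⟨n + 1, Fin.cons (g ∘ₗ (LinearMap.id - p)) h,
      Fin.cons ⟨a - p a, sub_mem ha (hle (hpmem a))⟩ fun k => ⟨x k, hle (x k).2⟩, fun y hy => ?_⟩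
    rw [Fin.sum_univ_succ]
    simp only [Fin.cons_zero, Fin.cons_succ, LinearMap.comp_apply, LinearMap.sub_apply,
      LinearMap.id_apply, ← hp]
    rw [Finset.coe_insert, Submodule.mem_span_insert] at hy
    obtain ⟨c, z, hz, rfl⟩ := hy
    have hpz : p z = z := by rw [hp, hx z hz]
    have : c • a + z - p (c • a + z) = c • (a - p a) := by
      rw [map_add, map_smul, hpz, smul_sub]; abel
    rw [this, map_smul, smul_assoc, hg, map_add, map_smul, hpz, smul_sub]
    abel

theorem IsRegularModule.finitePresentation_of_fg (hM : IsRegularModule R M) (N : Submodule R M)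
    (hN : N.FG) : Module.FinitePresentation R N := by
  obtain ⟨n, h, x, hx⟩ := hM.exists_dualBasis_of_fg N hN
  have : Module.Finite R N := Module.Finite.iff_fg.mpr hN
  have : Module.Projective R N := by
    refine Module.Projective.of_split (LinearMap.pi h ∘ₗ N.subtype)
      (Fintype.linearCombination R x) ?_
    ext y
    simpa [Fintype.linearCombination_apply] using hx y y.2
  exact Module.finitePresentation_of_projective R N

theorem IsRegularModule.isMittagLefflerModule (hM : IsRegularModule R M) :
    IsMittagLefflerModule R M := by
  intro I Q _ _
  refine (injective_iff_map_eq_zero _).mpr fun z hz => ?_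
  obtain ⟨s, m, q, rfl⟩ := TensorProduct.exists_sum_tmul_eq z
  obtain ⟨n, h, x, hx⟩ := hM.exists_dualBasis_of_fg (Submodule.span R (Set.range m))
    (Submodule.fg_span (Set.finite_range m))
  -- Contracting each component of `hz` with `h k` puts the relation in `Q i` itself.
  have hcoef (k : Fin n) : ∑ j, h k (m j) • q j = 0 := by
    ext i
    have := congrArg (fun w => TensorProduct.lid R (Q i) ((h k).rTensor (Q i) (w i))) hz
    simpa using this
  have hm (j : Fin s) : m j = ∑ k, h k (m j) • (x k : M) :=
    (hx _ (Submodule.subset_span ⟨j, rfl⟩)).symm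
  calc ∑ j, m j ⊗ₜ[R] q j = ∑ j, ∑ k, (x k : M) ⊗ₜ[R] (h k (m j) • q j) := by
        refine Finset.sum_congr rfl fun j _ => ?_
        conv_lhs => rw [hm j, TensorProduct.sum_tmul]
        simp_rw [TensorProduct.smul_tmul]
    _ = 0 := by
        rw [Finset.sum_comm]
        simp_rw [← TensorProduct.tmul_sum, hcoef, TensorProduct.tmul_zero, Finset.sum_const_zero]

theorem IsRegularModule.isStrictMittagLefflerModule (hM : IsRegularModule R M) :
    IsStrictMittagLefflerModule R M := by
  intro F _ _ _ a
  have hfg : (LinearMap.range a).FG := by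
    rw [LinearMap.range_eq_map]
    exact Module.Finite.fg_top.map a
  refine ⟨LinearMap.range a, inferInstance, inferInstance, a.rangeRestrict,
    hM.finitePresentation_of_fg _ hfg, ⟨(LinearMap.range a).subtype, rfl⟩, fun B _ _ f => ?_⟩
  obtain ⟨n, h, x, hx⟩ := hM.exists_dualBasis_of_fg _ hfg
  -- The dual basis sum maps `M` to the range of `a` and is the identity there.
  refine ⟨f ∘ₗ ∑ k, (h k).smulRight (x k), LinearMap.ext fun y => congrArg f (Subtype.ext ?_)⟩
  simpa using hx (a y) ⟨y, rfl⟩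

end Regular

/-! ### Mittag-Leffler conditions over a von Neumann regular ring -/

section VonNeumannRegular

variable {R : Type u} [CommRing R] {M : Type u} [AddCommGroup M] [Module R M]

theorem IsVonNeumannRegular.isRegularModule_fun (hR : IsVonNeumannRegular R) (n : ℕ) :
    IsRegularModule R (Fin n → R) := fun x => by
  obtain ⟨e, he, hspan⟩ := hR.exists_eq_span_of_fg (Ideal.span (Set.range x))
    (Submodule.fg_span (Set.finite_range x))
  have hmem : e ∈ Ideal.span (Set.range x) :=
    hspan ▸ Ideal.mem_span_singleton_self e
  obtain ⟨c, hc⟩ := (Submodule.mem_span_range_iff_exists_fun R).mp hmem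
  refine ⟨∑ i, c i • LinearMap.proj i, ?_⟩
  have hval : (∑ i, c i • LinearMap.proj (R := R) (φ := fun _ : Fin n => R) i) x = e := by
    simpa using hc
  rw [hval]
  ext i
  have hi : x i ∈ Ideal.span {e} := hspan ▸ Ideal.subset_span ⟨i, rfl⟩
  obtain ⟨y, hy⟩ := Ideal.mem_span_singleton'.mp hi
  rw [Pi.smul_apply, ← hy, smul_eq_mul, mul_left_comm, he.eq]

theorem IsVonNeumannRegular.isRegularModule_of_finitePresentation (hR : IsVonNeumannRegular R)
    [Module.FinitePresentation R M] : IsRegularModule R M := by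
  have := hR.flat M
  have : Module.Projective R M := Module.Flat.projective_of_finitePresentation
  obtain ⟨n, f, g, -, -, hfg⟩ := Module.Finite.exists_comp_eq_id_of_projective R M
  exact (hR.isRegularModule_fun n).of_injective g
    (Function.LeftInverse.injective (g := f) fun x => LinearMap.congr_fun hfg x)

/-- Strictness for `1 ↦ x`, tested on the identity of `S`, sends `x` to `v 1`; a form on the regular
module `S` then pulls back to `M`. -/
theorem IsStrictMittagLefflerModule.isRegularModule (hR : IsVonNeumannRegular R)
    (hM : IsStrictMittagLefflerModule R M) : IsRegularModule R M := fun x => by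
  obtain ⟨S, _, _, v, hS, ⟨b, hb⟩, hg⟩ := hM R inferInstance (LinearMap.toSpanSingleton R M x)
  obtain ⟨g, hg⟩ := hg S LinearMap.id
  obtain ⟨h, hh⟩ := hR.isRegularModule_of_finitePresentation (v 1)
  have hgx : g x = v 1 := by simpa using LinearMap.congr_fun hg 1
  have hbx : b (v 1) = x := by simpa using (LinearMap.congr_fun hb 1).symm
  refine ⟨h ∘ₗ g, ?_⟩
  rw [LinearMap.comp_apply, hgx]
  conv_lhs => rw [← hbx]
  rw [← map_smul, hh, hbx]

/-- Index a power of `R` by the kernel itself: the tautological tensor `∑ m i ⊗ q i` has component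
`f c = 0` at each `c`, so it vanishes. The equational criterion then yields finitely many relations
spanning the kernel. -/
theorem IsMittagLefflerModule.finitePresentation_range (hR : IsVonNeumannRegular R)
    (hM : IsMittagLefflerModule R M) {n : ℕ} (f : (Fin n → R) →ₗ[R] M) :
    Module.FinitePresentation R (LinearMap.range f) := by
  refine Module.finitePresentation_of_surjective f.rangeRestrict f.surjective_rangeRestrict ?_
  rw [LinearMap.ker_rangeRestrict]
  let m : Fin n → M := fun i => f fun j => if i = j then 1 else 0
  have hf (c : Fin n → R) : f c = ∑ i, c i • m i := f.pi_apply_eq_sum_univ c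
  let q : Fin n → LinearMap.ker f → R := fun i c => c.1 i
  have hzero : ∑ i, m i ⊗ₜ[R] q i = 0 := by
    refine (injective_iff_map_eq_zero _).mp (hM (LinearMap.ker f) fun _ => R) _ ?_
    ext c
    refine (TensorProduct.rid R M).injective ?_
    simpa [q, hf] using LinearMap.mem_ker.mp c.2
  have := hR.flat (LinearMap.ker f → R)
  obtain ⟨k, a, y, hay, ha⟩ :=
    TensorProduct.vanishesTrivially_of_sum_tmul_eq_zero_of_rTensor_injective R
      (Module.Flat.rTensor_preserves_injective_linearMap _ (Submodule.injective_subtype _)) hzero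
  have hspan : LinearMap.ker f = Submodule.span R (Set.range fun j i => a i j) := by
    refine le_antisymm (fun c hc => ?_) (Submodule.span_le.mpr ?_)
    · rw [Submodule.mem_span_range_iff_exists_fun]
      refine ⟨fun j => y j ⟨c, hc⟩, funext fun i => ?_⟩
      have := congrFun (hay i) ⟨c, hc⟩
      simp only [q, Finset.sum_apply, Pi.smul_apply, smul_eq_mul] at this
      simp [this, mul_comm]
    · rintro _ ⟨j, rfl⟩
      rw [SetLike.mem_coe, LinearMap.mem_ker, hf, ha j]
  rw [hspan]
  exact Submodule.fg_span (Set.finite_range _)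

theorem IsMittagLefflerModule.finitePresentation_of_fg (hR : IsVonNeumannRegular R)
    (hM : IsMittagLefflerModule R M) (N : Submodule R M) (hN : N.FG) :
    Module.FinitePresentation R N := by
  obtain ⟨n, s, rfl⟩ := Submodule.fg_iff_exists_fin_generating_family.mp hN
  rw [← Fintype.range_linearCombination]
  exact hM.finitePresentation_range hR _

/-- The form obtained lives only on `R ∙ x` and need not extend to `M`; its value at `x` is what
survives. -/
theorem IsMittagLefflerModule.hasSupportElements (hR : IsVonNeumannRegular R)
    (hM : IsMittagLefflerModule R M) : HasSupportElements R M := fun x => by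
  have := hM.finitePresentation_of_fg hR (R ∙ x) (Submodule.fg_span_singleton x)
  obtain ⟨e, he, hann⟩ := hR.isRegularModule_of_finitePresentation.hasSupportElements
    (⟨x, Submodule.mem_span_singleton_self x⟩ : R ∙ x)
  exact ⟨e, congrArg Subtype.val he, fun r hr => hann r (Subtype.ext hr)⟩

end VonNeumannRegular

/-! ### Consequences of self-injectivity -/

section SelfInjective

variable {R : Type u} [CommRing R]

/-- The annihilator condition makes `r • x ↦ r * e` well defined on the cyclic submodule, and
injectivity extends it to `M`. -/
theorem HasSupportElements.isRegularModule [Module.Injective R R]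
    {M : Type u} [AddCommGroup M] [Module R M] (hM : HasSupportElements R M) :
    IsRegularModule R M := fun x => by
  obtain ⟨e, he, hann⟩ := hM x
  let φ := LinearMap.toSpanSingleton R M x
  have hle : LinearMap.ker φ ≤ LinearMap.ker (LinearMap.toSpanSingleton R R e) :=
    fun r hr => hann r hr
  obtain ⟨h, hh⟩ := Module.Injective.out ((LinearMap.ker φ).liftQ φ le_rfl)
    (LinearMap.ker_eq_bot.mp (Submodule.ker_liftQ_eq_bot _ _ _ le_rfl))
    ((LinearMap.ker φ).liftQ _ hle)
  have hx : h x = e := by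
    have := hh (Submodule.Quotient.mk 1)
    rwa [Submodule.liftQ_apply, Submodule.liftQ_apply, LinearMap.toSpanSingleton_apply,
      LinearMap.toSpanSingleton_apply, one_smul, one_smul] at this
  exact ⟨h, hx ▸ he⟩

/-- In a self-injective von Neumann regular ring, every family of elements has a joint support. -/
theorem IsVonNeumannRegular.exists_joint_support [Module.Injective R R]
    (hR : IsVonNeumannRegular R) {ι : Type u} (e : ι → R) :
    ∃ s : R, (∀ i, s * e i = e i) ∧ ∀ r : R, (∀ i, r * e i = 0) → r * s = 0 := by
  let J : Ideal R := Ideal.span (Set.range e)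
  let A : Ideal R := Submodule.annihilator J
  have hinj : Function.Injective ((Submodule.subtype J).coprod (Submodule.subtype A)) := by
    refine (injective_iff_map_eq_zero _).mpr ?_
    rintro ⟨⟨a, ha⟩, ⟨b, hb⟩⟩ hab
    replace hab : a + b = 0 := hab
    have hba : b * a = 0 := Submodule.mem_annihilator.mp hb a ha
    have ha0 : a = 0 := by
      obtain ⟨x, hx⟩ := hR a
      have haa : a * a = 0 := by linear_combination a * hab - hba
      rw [hx]
      linear_combination x * haa
    subst ha0
    have hb0 : b = 0 := by simpa using hab
    subst hb0
    rfl
  -- Extend the projection of `J ⊕ A` onto `J` to all of `R`; the support is its value at `1`.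
  obtain ⟨h, hh⟩ := Module.Injective.out _ hinj (Submodule.subtype J ∘ₗ LinearMap.fst R J A)
  have hmul (r : R) : r * h 1 = h r := by rw [← smul_eq_mul, ← map_smul, smul_eq_mul, mul_one]
  refine ⟨h 1, fun i => ?_, fun r hr => ?_⟩
  · have := hh (⟨e i, Ideal.subset_span ⟨i, rfl⟩⟩, 0)
    rw [mul_comm, hmul]
    simpa using this
  · have hrA : r ∈ A := by
      rw [Submodule.mem_annihilator_span]
      rintro ⟨_, i, rfl⟩
      exact hr i
    have := hh (0, ⟨r, hrA⟩)
    rw [hmul]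
    simpa using this

theorem IsVonNeumannRegular.hasSupportElements_pi [Module.Injective R R]
    (hR : IsVonNeumannRegular R) {I : Type u} {M : I → Type u} [∀ i, AddCommGroup (M i)]
    [∀ i, Module R (M i)] (hM : ∀ i, HasSupportElements R (M i)) :
    HasSupportElements R (∀ i, M i) := fun x => by
  choose e he hann using fun i => hM i (x i)
  obtain ⟨s, hs, hs'⟩ := hR.exists_joint_support e
  refine ⟨s, funext fun i => ?_, fun r hr => hs' r fun i => hann i r (congrFun hr i)⟩
  rw [Pi.smul_apply, ← he i, ← smul_assoc, smul_eq_mul, hs]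

end SelfInjective

/-- The denominators `b` for which `b * f` is multiplication by a scalar form an ideal `B`, finitely
generated by π-coherence, so generated by an idempotent `g`. It contains `J`, by commutativity, so
`1 - g` kills `J` and hence `f`. Thus `1 - g`, and with it `1`, is a denominator. -/
theorem IsPiCoherent.injective_self {R : Type u} [CommRing R] (hR : IsVonNeumannRegular R)
    (h : IsPiCoherent R) : Module.Injective R R := by
  refine Module.Baer.injective fun J f => ?_
  have hcomm (a b : J) : (a : R) * f b = b * f a := by
    rw [← smul_eq_mul, ← map_smul, ← smul_eq_mul, ← map_smul]
    exact congrArg f (Subtype.ext (mul_comm _ _))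
  -- The kernel consists of the pairs `(a, b)` such that `f` is multiplication by `a` on `b J`.
  let φ : R × R →ₗ[R] (J → R) :=
    (LinearMap.toSpanSingleton R (J → R) fun j => (j : R)).coprod
      (-LinearMap.toSpanSingleton R (J → R) fun j => f j)
  have hφ (a b : R) : (a, b) ∈ LinearMap.ker φ ↔ ∀ j : J, a * j = b * f j := by
    rw [LinearMap.mem_ker, funext_iff]
    refine forall_congr' fun j => ?_
    simp [φ, ← sub_eq_add_neg, sub_eq_zero]
  have hker : (LinearMap.ker φ).FG := by
    have : Module.FinitePresentation R (LinearMap.range φ) := h J _ (by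
      rw [LinearMap.range_eq_map]
      exact Module.Finite.fg_top.map φ)
    rw [← LinearMap.ker_rangeRestrict]
    exact Module.FinitePresentation.fg_ker _ φ.surjective_rangeRestrict
  let B : Ideal R := (LinearMap.ker φ).map (LinearMap.snd R R R)
  have hB (b : R) : b ∈ B ↔ ∃ a : R, ∀ j : J, a * j = b * f j := by
    simp only [B, Submodule.mem_map, Prod.exists, hφ, LinearMap.snd_apply]
    exact ⟨fun ⟨a, _, ha, hb⟩ => ⟨a, hb ▸ ha⟩, fun ⟨a, ha⟩ => ⟨a, b, ha, rfl⟩⟩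
  obtain ⟨g, hg, hBg⟩ := hR.exists_eq_span_of_fg B (hker.map _)
  have hJ (j : J) : (1 - g) * (j : R) = 0 := by
    have : (j : R) ∈ Ideal.span {g} := hBg ▸ (hB _).mpr ⟨f j, fun i => by rw [mul_comm, hcomm]⟩
    obtain ⟨y, hy⟩ := Ideal.mem_span_singleton'.mp this
    rw [← hy]
    linear_combination -y * hg.eq
  have h1 : (1 : R) ∈ B := by
    have hgB : g ∈ B := hBg ▸ Ideal.mem_span_singleton_self g
    have hgB' : 1 - g ∈ B := (hB _).mpr ⟨0, fun j => by
      rw [zero_mul, ← smul_eq_mul, ← map_smul, eq_comm]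
      convert map_zero f
      exact Subtype.ext (hJ j)⟩
    simpa using B.add_mem hgB hgB'
  obtain ⟨a, ha⟩ := (hB 1).mp h1
  exact ⟨LinearMap.lsmul R R a, fun x hx => by simpa using ha ⟨x, hx⟩⟩

theorem mainTheorem8 (R : Type u) [CommRing R] (hR : IsVonNeumannRegular R) :
    List.TFAE
      [IsPiCoherent R,
       IsClosedUnderProducts R (fun M _ _ => IsFlatMittagLeffler R M),
       Module.Injective R R,
       IsStronglyCoherent R] := by
  have hself : IsRegularModule R R := hR.isRegularModule_of_finitePresentation
  tfae_have 1 → 3 := fun h => h.injective_self hR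
  tfae_have 3 → 2 := fun _ I M _ _ hM =>
    ⟨hR.flat _, (hR.hasSupportElements_pi fun i =>
      (hM i).2.hasSupportElements hR).isRegularModule.isMittagLefflerModule⟩
  tfae_have 3 → 4 := fun _ I M _ _ hM =>
    ⟨hR.flat _, (hR.hasSupportElements_pi fun i =>
      ((hM i).2.isRegularModule hR).hasSupportElements).isRegularModule.isStrictMittagLefflerModule⟩
  tfae_have 2 → 1 := fun h I N hN =>
    (h I (fun _ => R) fun _ => ⟨hR.flat R, hself.isMittagLefflerModule⟩).2.finitePresentation_of_fg
      hR N hN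
  tfae_have 4 → 1 := fun h I N hN =>
    ((h I (fun _ => R) fun _ =>
      ⟨hR.flat R, hself.isStrictMittagLefflerModule⟩).2.isRegularModule hR).finitePresentation_of_fg
        N hN
  tfae_finish
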